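/- Theorem (LLN for the MERW with random step sizes, superdiffusive regime). Let $d\ge 1$, $\frac{2d+1}{4d}<p\le 1$ and $\gamma=\frac{2dp-1}{2d-1}$. Let $I_d$ be the $d\times d$ identity matrix and $J_d$ the cyclic shift matrix whose $i$-th row has its only nonzero entry, a $1$, in column $i+1$ (column $1$ if $i=d$). On a probability space $(\Omega,\mathcal F,\mathbb P)$ consider the multidimensional elephant random walk (MERW) with random step sizes. Here $X_1$ is uniformly distributed on $\{\pm e_1,\dots,\pm e_d\}\subset\mathbb R^d$ and, for $n\ge 1$, $$X_{n+1}=A_{n+1}X_{\beta(n)}\quad\text{a.s.},$$ where $\beta(n)$ is uniform on $\{1,\dots,n\}$ and $A_{n+1}$ equals $I_d$ with probability $p$ and each of the $2d-1$ matrices $-I_d,\pm J_d,\pm J_d^2,\dots,\pm J_d^{d-1}$ with probability $\frac{1-p}{2d-1}$. The step sizes are a random variable $Y_1>0$ with finite mean and variance and i.i.d. random variables $Y_2,Y_3,\dots\ge 0$ with finite mean $\mu$ and finite variance. For each $n\ge 1$, the variables $A_{n+1}$, $\beta(n)$, $Y_{n+1}$ are mutually independent, and they are jointly independent of $(X_1,\dots,X_n,Y_1,\dots,Y_n)$.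 Put $$W_n=\sum_{k=1}^n X_k,\qquad S_n=\sum_{k=1}^n Y_kX_k .$$ Then there is a random vector $S$ in $\mathbb R^d$, non-degenerate in the sense that $\mathbb P(\langle u,S\rangle=c)<1$ for all $u\in\mathbb R^d\setminus\{0\}$ and $c\in\mathbb R$ (so in particular not almost surely constant), such that $$\lim_{n\to\infty}\frac{W_n}{n^\gamma}=S\quad\text{a.s.}\qquad\text{and}\qquad\lim_{n\to\infty}\frac{S_n}{n^\gamma}=\mu S\quad\text{a.s.}$$ -/

import Mathlib

open MeasureTheory ProbabilityTheory Filter Topology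

noncomputable section

/-- The product (entrywise, Borel) σ-algebra on real matrices. -/
instance matrixMeasurableSpace (d : ℕ) : MeasurableSpace (Matrix (Fin d) (Fin d) ℝ) :=
  inferInstanceAs (MeasurableSpace (Fin d → Fin d → ℝ))

/-- The cyclic shift matrix `J_d`: row `i` has its only nonzero entry, a `1`, in column `i + 1`
modulo `d`. -/
def cyclicShift (d : ℕ) : Matrix (Fin d) (Fin d) ℝ :=
  Matrix.of fun i j => if (j : ℕ) = ((i : ℕ) + 1) % d then 1 else 0

/-- The multidimensional elephant random walk (MERW) on `ℤ^d` with memory parameter `p` and random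
step sizes, on a probability space `(Ω, P)`. Times start at `1`; the values `X 0`, `Y 0`, `A 0`,
`A 1`, `β 0` play no role.
* `X k` is the `k`-th unit step of the MERW,
* `A (n + 1)` is the random matrix that is applied at time `n + 1`,
* `β n` is the uniformly chosen past time,
* `Y k` is the size of the `k`-th step. -/
structure IsMERWRandomSteps {Ω : Type*} [MeasurableSpace Ω] (P : Measure Ω) (d : ℕ) (p : ℝ)
    (X : ℕ → Ω → EuclideanSpace ℝ (Fin d)) (A : ℕ → Ω → Matrix (Fin d) (Fin d) ℝ)
    (β : ℕ → Ω → ℕ) (Y : ℕ → Ω → ℝ) : Prop where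
  measurable_X : ∀ k, 1 ≤ k → Measurable (X k)
  measurable_A : ∀ n, 1 ≤ n → Measurable (A (n + 1))
  measurable_β : ∀ n, 1 ≤ n → Measurable (β n)
  measurable_Y : ∀ k, 1 ≤ k → Measurable (Y k)
  /-- The first step is uniform on `{±e_1, …, ±e_d}`. -/
  first_pos : ∀ i : Fin d, P.real {ω | X 1 ω = EuclideanSpace.single i 1} = 1 / (2 * d)
  first_neg : ∀ i : Fin d, P.real {ω | X 1 ω = -EuclideanSpace.single i 1} = 1 / (2 * d)
  /-- `X_{n+1} = A_{n+1} X_{β(n)}`. -/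
  step : ∀ n, 1 ≤ n → ∀ᵐ ω ∂P,
    X (n + 1) ω = Matrix.toEuclideanLin (A (n + 1) ω) (X (β n ω) ω)
  /-- `β(n)` is uniform on `{1, …, n}`. -/
  law_β : ∀ n, 1 ≤ n → ∀ k ∈ Finset.Icc 1 n, P.real {ω | β n ω = k} = 1 / n
  /-- `A_{n+1}` is `I_d` with probability `p`, and each of the other `2d - 1` matrices
  `-I_d, ±J_d, …, ±J_d^{d-1}` with probability `(1 - p) / (2d - 1)`. -/
  law_A_id : ∀ n, 1 ≤ n → P.real {ω | A (n + 1) ω = 1} = p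
  law_A_neg_id : ∀ n, 1 ≤ n → P.real {ω | A (n + 1) ω = -1} = (1 - p) / (2 * d - 1)
  law_A_pow : ∀ n, 1 ≤ n → ∀ i ∈ Finset.Icc 1 (d - 1),
    P.real {ω | A (n + 1) ω = cyclicShift d ^ i} = (1 - p) / (2 * d - 1)
  law_A_neg_pow : ∀ n, 1 ≤ n → ∀ i ∈ Finset.Icc 1 (d - 1),
    P.real {ω | A (n + 1) ω = -cyclicShift d ^ i} = (1 - p) / (2 * d - 1)
  /-- The first step size is positive with finite mean and variance. -/
  pos_Y_one : ∀ᵐ ω ∂P, 0 < Y 1 ω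
  memLp_Y_one : MemLp (Y 1) 2 P
  /-- The later step sizes are non-negative, i.i.d., with finite mean and variance. -/
  nonneg_Y : ∀ k, 2 ≤ k → ∀ᵐ ω ∂P, 0 ≤ Y k ω
  memLp_Y : ∀ k, 2 ≤ k → MemLp (Y k) 2 P
  identDistrib_Y : ∀ k, 2 ≤ k → IdentDistrib (Y k) (Y 2) P P
  iIndepFun_Y : iIndepFun (fun k : {k : ℕ // 2 ≤ k} => Y k) P
  /-- `A_{n+1}`, `β(n)`, `Y_{n+1}` are mutually independent ... -/
  indep_A : ∀ n, 1 ≤ n → IndepFun (A (n + 1)) (fun ω => (β n ω, Y (n + 1) ω)) P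
  indep_β_Y : ∀ n, 1 ≤ n → IndepFun (β n) (Y (n + 1)) P
  /-- ... and jointly independent of the past `X_1, …, X_n, Y_1, …, Y_n`. -/
  indep_past : ∀ n, 1 ≤ n → IndepFun (fun ω => (A (n + 1) ω, β n ω, Y (n + 1) ω))
    (fun ω (k : Finset.Icc 1 n) => (X k ω, Y k ω)) P

/-- The position `W_n = X_1 + ⋯ + X_n` of the MERW. -/
def merwPosition {Ω : Type*} {d : ℕ} (X : ℕ → Ω → EuclideanSpace ℝ (Fin d)) (n : ℕ) (ω : Ω) :
    EuclideanSpace ℝ (Fin d) :=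
  ∑ k ∈ Finset.Icc 1 n, X k ω

/-- The position `S_n = T_1 + ⋯ + T_n`, `T_k = Y_k X_k`, of the MERW with random step sizes. -/
def randomStepPosition {Ω : Type*} {d : ℕ} (X : ℕ → Ω → EuclideanSpace ℝ (Fin d))
    (Y : ℕ → Ω → ℝ) (n : ℕ) (ω : Ω) : EuclideanSpace ℝ (Fin d) :=
  ∑ k ∈ Finset.Icc 1 n, Y k ω • X k ω

/-- A random vector is non-degenerate if its law is not carried by any affine hyperplane; in
particular it is then not almost surely constant in positive dimension. -/
def IsNondegenerate {Ω : Type*} [MeasurableSpace Ω] {d : ℕ} (P : Measure Ω)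
    (S : Ω → EuclideanSpace ℝ (Fin d)) : Prop :=
  ∀ u : EuclideanSpace ℝ (Fin d), u ≠ 0 → ∀ c : ℝ, ¬ ∀ᵐ ω ∂P, inner ℝ u (S ω) = c

end

noncomputable section

/-! The matrices `±J_d^k` cancel in pairs, so the mean of `A_{n+1}` is `γ I_d`: given the past,
`X_{n+1}` has mean `γ W_n / n`. Hence each coordinate of `W_{n+1}`, multiplied by `merwNormalizer γ
n`, is a martingale. The normalizer decays like `n^{-γ}` and the steps are bounded, so for `γ > 1/2`
the increments have summable second moments; the martingale is uniformly integrable and converges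
almost surely (`ae_tendsto_sum_X`).

For random sizes, write `Y_k X_k = μ X_k + (Y_k - μ) X_k`. The centred terms are martingale
differences; divided by `(k-1)^γ` they again form an `L²`-bounded martingale, so Kronecker's lemma
makes their unweighted sum `o(n^γ)` (`ae_tendsto_fluctuation`).

The limit is non-degenerate because a uniformly integrable martingale is closed by its limit:
conditioning the limit on time `1` returns `X_1`, up to a constant factor, and `X_1` lies almost
surely on no fixed affine hyperplane (`isNondegenerate_limitVector`). Both martingales rest on the
single computation `setIntegral_mul_X_succ`. -/

/-! ### The normalizing sequence and its asymptotics. -/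

/-- The normalizing sequence `∏_{k=1}^{n} k / (k + γ)`. -/
def merwNormalizer (γ : ℝ) (n : ℕ) : ℝ :=
  ∏ k ∈ Finset.range n, ((k : ℝ) + 1) / (k + 1 + γ)

lemma merwNormalizer_zero (γ : ℝ) : merwNormalizer γ 0 = 1 := by
  simp [merwNormalizer]

lemma merwNormalizer_succ (γ : ℝ) (n : ℕ) :
    merwNormalizer γ (n + 1) = merwNormalizer γ n * (((n : ℝ) + 1) / (n + 1 + γ)) :=
  Finset.prod_range_succ _ _

lemma merwNormalizer_pos {γ : ℝ} (hγ : 0 < γ) (n : ℕ) : 0 < merwNormalizer γ n :=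
  Finset.prod_pos fun k _ => by positivity

/-- The one-step identity that makes the normalized walk a martingale. -/
lemma merwNormalizer_succ_mul {γ : ℝ} (hγ : 0 < γ) (n : ℕ) :
    merwNormalizer γ (n + 1) * (1 + γ / (n + 1)) = merwNormalizer γ n := by
  rw [merwNormalizer_succ]
  have h1 : (n : ℝ) + 1 + γ ≠ 0 := by positivity
  have h2 : (n : ℝ) + 1 ≠ 0 := by positivity
  field_simp

/-- Euler's product for `Γ(γ)` has the additional factor `γ + 0` in its denominator, which accounts
for the `γ` on the right. -/
lemma merwNormalizer_eq_gammaSeq {γ : ℝ} (hγ : 0 < γ) (n : ℕ) :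
    (n : ℝ) ^ γ * merwNormalizer γ n = γ * Real.GammaSeq γ n := by
  have h : ∀ n : ℕ, merwNormalizer γ n = γ * (n.factorial : ℝ) /
      ∏ j ∈ Finset.range (n + 1), (γ + j) := by
    intro n
    induction n with
    | zero => simp [merwNormalizer_zero, hγ.ne']
    | succ n ih =>
      have h1 : (n : ℝ) + 1 + γ ≠ 0 := by positivity
      have h2 : ∏ j ∈ Finset.range (n + 1), (γ + (j : ℝ)) ≠ 0 :=
        (Finset.prod_pos fun k _ => by positivity).ne'
      have h3 : γ + ((n : ℝ) + 1) ≠ 0 := by positivity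
      rw [merwNormalizer_succ, ih, Finset.prod_range_succ _ (n + 1), Nat.factorial_succ]
      push_cast
      field_simp
      ring
  rw [h, Real.GammaSeq]
  ring

/-- The power is taken at `n + 1` because `merwNormalizer γ n` will multiply the walk at time `n +
1`. -/
lemma tendsto_add_one_rpow_mul_merwNormalizer {γ : ℝ} (hγ : 0 < γ) :
    Tendsto (fun n : ℕ => ((n : ℝ) + 1) ^ γ * merwNormalizer γ n) atTop
      (𝓝 (γ * Real.Gamma γ)) := by
  have h1 : Tendsto (fun n : ℕ => (n : ℝ) ^ γ * merwNormalizer γ n) atTop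
      (𝓝 (γ * Real.Gamma γ)) := by
    simp_rw [merwNormalizer_eq_gammaSeq hγ]
    exact (Real.GammaSeq_tendsto_Gamma γ).const_mul γ
  have h2 : Tendsto (fun n : ℕ => (1 + 1 / (n : ℝ)) ^ γ) atTop (𝓝 1) := by
    have : Tendsto (fun n : ℕ => 1 + 1 / (n : ℝ)) atTop (𝓝 1) := by
      simpa using tendsto_one_div_atTop_nhds_zero_nat.const_add (1 : ℝ)
    simpa using this.rpow_const (p := γ) (Or.inl one_ne_zero)
  have h3 := h2.mul h1
  rw [one_mul] at h3
  refine h3.congr' ?_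
  filter_upwards [eventually_gt_atTop 0] with n hn
  have hn' : (0 : ℝ) < n := by exact_mod_cast hn
  rw [← mul_assoc, ← Real.mul_rpow (by positivity) hn'.le]
  congr 2
  field_simp

lemma summable_sq_merwNormalizer {γ : ℝ} (hγ : 1 / 2 < γ) :
    Summable fun n : ℕ => merwNormalizer γ n ^ 2 := by
  have hγ0 : 0 < γ := by linarith
  obtain ⟨C, hC⟩ := (tendsto_add_one_rpow_mul_merwNormalizer hγ0).bddAbove_range
  have hs : Summable fun n : ℕ => C ^ 2 * (1 / ((n + 1 : ℕ) : ℝ) ^ (2 * γ)) :=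
    ((summable_nat_add_iff 1).2
      (Real.summable_one_div_nat_rpow.2 (by linarith : 1 < 2 * γ))).mul_left _
  refine Summable.of_nonneg_of_le (fun n => sq_nonneg _) (fun n => ?_) hs
  have h := hC ⟨n, rfl⟩
  have hp : (0 : ℝ) < ((n : ℝ) + 1) ^ γ := by positivity
  have hsq : ((n : ℝ) + 1) ^ (2 * γ) = (((n : ℝ) + 1) ^ γ) ^ 2 := by
    rw [← Real.rpow_natCast, ← Real.rpow_mul (by positivity)]
    congr 1
    push_cast
    ring
  simp only at h
  push_cast
  rw [hsq, mul_one_div, le_div_iff₀ (by positivity), ← mul_pow]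
  have h0 := merwNormalizer_pos hγ0 n
  exact pow_le_pow_left₀ (by positivity) (by linarith) 2

/-! ### Kronecker's lemma. -/

/-- **Kronecker's lemma**. -/
lemma tendsto_sum_div_of_tendsto_sum {x b : ℕ → ℝ} {s : ℝ} (hb : Monotone b)
    (hb_top : Tendsto b atTop atTop)
    (hx : Tendsto (fun n => ∑ k ∈ Finset.range n, x k) atTop (𝓝 s)) :
    Tendsto (fun n => (∑ k ∈ Finset.range n, b k * x k) / b n) atTop (𝓝 0) := by
  set t : ℕ → ℝ := fun n => (∑ k ∈ Finset.range n, x k) - s with ht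
  have ht0 : Tendsto t atTop (𝓝 0) := by simpa [ht] using hx.sub_const s
  -- Summation by parts against the remainders `t`, which tend to zero.
  have habel : ∀ n, ∑ k ∈ Finset.range n, b k * x k =
      b n * t n + b 0 * s - ∑ k ∈ Finset.range n, (b (k + 1) - b k) * t (k + 1) := by
    intro n
    induction n with
    | zero => simp [ht]
    | succ n ih =>
      rw [Finset.sum_range_succ, ih, Finset.sum_range_succ _ n]
      have : t (n + 1) = t n + x n := by simp only [ht, Finset.sum_range_succ]; ring
      rw [this]
      ring
  have hsum : ∀ n, ∑ k ∈ Finset.range n, (b (k + 1) - b k) = b n - b 0 :=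
    fun n => Finset.sum_range_sub b n
  -- Weighted Cesàro argument: a null sequence averaged with nonnegative weights of divergent total
  -- is negligible against that total.
  have ho : (fun n => ∑ k ∈ Finset.range n, (b (k + 1) - b k) * t (k + 1)) =o[atTop]
      fun n => ∑ k ∈ Finset.range n, (b (k + 1) - b k) := by
    refine Asymptotics.IsLittleO.sum_range ?_ (fun n => sub_nonneg.2 (hb n.le_succ)) ?_
    · have h1 : (fun n => t (n + 1)) =o[atTop] fun _ : ℕ => (1 : ℝ) :=
        (Asymptotics.isLittleO_one_iff ℝ).2 ((tendsto_add_atTop_iff_nat 1).2 ht0)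
      simpa using (Asymptotics.isBigO_refl (fun n => b (n + 1) - b n) atTop).mul_isLittleO h1
    · simp_rw [hsum]
      exact tendsto_atTop_add_const_right _ _ hb_top
  simp_rw [hsum] at ho
  have hO : (fun n => b n - b 0) =O[atTop] b := by
    refine (Asymptotics.isBigO_refl b atTop).sub ?_
    exact (Asymptotics.isLittleO_const_left.2
      (Or.inr (tendsto_norm_atTop_atTop.comp hb_top))).isBigO
  have h2 : Tendsto (fun n => b 0 * s / b n) atTop (𝓝 0) := hb_top.const_div_atTop _
  have h3 := ((ht0.add h2).sub (ho.trans_isBigO hO).tendsto_div_nhds_zero)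
  simp only [add_zero, sub_zero] at h3
  refine h3.congr' ?_
  filter_upwards [hb_top.eventually_gt_atTop 0] with n hn
  rw [habel]
  field_simp

/-! ### Uniform integrability from second moments, and finitely supported variables. -/

section General

variable {Ω : Type*} {m0 : MeasurableSpace Ω} {P : Measure Ω} [IsProbabilityMeasure P]

lemma uniformIntegrable_one_of_integral_sq_le {f : ℕ → Ω → ℝ} (hf : ∀ n, MemLp (f n) 2 P) {C : ℝ}
    (hC : ∀ n, ∫ ω, f n ω ^ 2 ∂P ≤ C) : UniformIntegrable f 1 P := by
  refine uniformIntegrable_of le_rfl ENNReal.one_ne_top (fun n => (hf n).1) fun ε hε => ?_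
  have hC0 : 0 ≤ C := (integral_nonneg fun ω => sq_nonneg _).trans (hC 0)
  -- On `{|f| ≥ K}` one has `|f| ≤ f² / K`, so the tail integral is at most `C / K ≤ ε`; the `+ 1`
  -- keeps `K` positive when `C = 0`.
  set K : ℝ := C / ε + 1 with hK
  have hKpos : 0 < K := by positivity
  refine ⟨K.toNNReal, fun n => ?_⟩
  have hint : Integrable (fun ω => f n ω ^ 2 / K) P := (hf n).integrable_sq.div_const K
  rw [eLpNorm_one_eq_lintegral_enorm]
  calc ∫⁻ ω, ‖({ x | K.toNNReal ≤ ‖f n x‖₊ }.indicator (f n)) ω‖ₑ ∂P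
      ≤ ∫⁻ ω, ENNReal.ofReal (f n ω ^ 2 / K) ∂P := by
        refine lintegral_mono fun ω => ?_
        by_cases hω : ω ∈ { x | K.toNNReal ≤ ‖f n x‖₊ }
        · rw [Set.indicator_of_mem hω, ← ofReal_norm]
          refine ENNReal.ofReal_le_ofReal ?_
          have h1 : K ≤ |f n ω| := by
            have := NNReal.coe_le_coe.2 (Set.mem_ofPred_eq ▸ hω)
            rwa [Real.coe_toNNReal _ hKpos.le] at this
          rw [le_div_iff₀ hKpos, Real.norm_eq_abs, ← sq_abs, sq]
          exact mul_le_mul_of_nonneg_left h1 (abs_nonneg _)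
        · rw [Set.indicator_of_notMem hω]
          simp
    _ = ENNReal.ofReal (∫ ω, f n ω ^ 2 / K ∂P) :=
        (ofReal_integral_eq_lintegral_ofReal hint
          (ae_of_all _ fun ω => by positivity)).symm
    _ ≤ ENNReal.ofReal ε := by
        refine ENNReal.ofReal_le_ofReal ?_
        rw [integral_div, div_le_iff₀ hKpos]
        have : ε * K = C + ε := by rw [hK]; field_simp
        linarith [hC n]

/-- A square integrable martingale whose increments have summable second moments is uniformly
integrable. -/
lemma uniformIntegrable_martingale_of_summable {ℱ : Filtration ℕ m0} {f : ℕ → Ω → ℝ}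
    (hf : Martingale f ℱ P) (hL2 : ∀ n, MemLp (f n) 2 P) {b : ℕ → ℝ}
    (hb : ∀ n, ∫ ω, (f (n + 1) ω - f n ω) ^ 2 ∂P ≤ b n) (hsum : Summable b) :
    UniformIntegrable f 1 P := by
  have hb0 : ∀ n, 0 ≤ b n := fun n => (integral_nonneg fun ω => sq_nonneg _).trans (hb n)
  -- Orthogonality of increments to the past, by pulling `f n` out of the conditional expectation;
  -- second moments then grow only by those of the increments.
  have horth : ∀ n, ∫ ω, f n ω * f (n + 1) ω ∂P = ∫ ω, f n ω ^ 2 ∂P := by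
    intro n
    have hint : Integrable (f n * f (n + 1)) P := (hL2 n).integrable_mul (hL2 (n + 1))
    have h1 := condExp_mul_of_stronglyMeasurable_left (hf.stronglyMeasurable n) hint
      (hf.integrable (n + 1))
    have h2 := hf.condExp_ae_eq n.le_succ
    have h3 := integral_condExp (μ := P) (f := f n * f (n + 1)) (ℱ.le n)
    change ∫ ω, (f n * f (n + 1)) ω ∂P = _
    rw [← h3]
    refine integral_congr_ae ?_
    filter_upwards [h1, h2] with ω h1 h2
    rw [h1, Pi.mul_apply, h2, sq]
  have hstep : ∀ n, ∫ ω, f (n + 1) ω ^ 2 ∂P ≤ ∫ ω, f n ω ^ 2 ∂P + b n := by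
    intro n
    have hexp : ∫ ω, (f (n + 1) ω - f n ω) ^ 2 ∂P =
        ∫ ω, f (n + 1) ω ^ 2 ∂P - 2 * ∫ ω, f n ω * f (n + 1) ω ∂P + ∫ ω, f n ω ^ 2 ∂P := by
      have hint : Integrable (fun ω => f n ω * f (n + 1) ω) P :=
        (hL2 n).integrable_mul (hL2 (n + 1))
      rw [← integral_const_mul, ← integral_sub (hL2 (n + 1)).integrable_sq (hint.const_mul 2),
        ← integral_add (by exact (hL2 (n + 1)).integrable_sq.sub (hint.const_mul 2))
          (hL2 n).integrable_sq]
      refine integral_congr_ae (ae_of_all _ fun ω => ?_)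
      simp only
      ring
    rw [horth] at hexp
    linarith [hb n]
  have hbound : ∀ n, ∫ ω, f n ω ^ 2 ∂P ≤ ∫ ω, f 0 ω ^ 2 ∂P + ∑ k ∈ Finset.range n, b k := by
    intro n
    induction n with
    | zero => simp
    | succ n ih => rw [Finset.sum_range_succ]; linarith [hstep n]
  exact uniformIntegrable_one_of_integral_sq_le hL2 fun n => (hbound n).trans
    (add_le_add_right (hsum.sum_le_tsum _ fun k _ => hb0 k) _)

variable {E : Type*} [MeasurableSpace E] [MeasurableSingletonClass E] {ι : Type*} [Fintype ι]

/-- A random variable that takes the distinct values `v i` with total probability `1` takes no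
other value. -/
lemma ae_exists_eq_of_sum_eq_one {Z : Ω → E} (hZ : Measurable Z) {v : ι → E}
    (hv : Function.Injective v) (h : ∑ i, P.real {ω | Z ω = v i} = 1) :
    ∀ᵐ ω ∂P, ∃ i, Z ω = v i := by
  have hm : ∀ i, MeasurableSet {ω | Z ω = v i} := fun i => hZ (measurableSet_singleton (v i))
  have hd : Pairwise (Function.onFun Disjoint fun i => {ω | Z ω = v i}) := by
    intro i j hij
    refine Set.disjoint_left.2 fun ω (h1 : Z ω = v i) (h2 : Z ω = v j) => hij (hv (h1 ▸ h2))
  have hU : P.real (⋃ i, {ω | Z ω = v i}) = 1 := by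
    rw [measureReal_iUnion_fintype hd hm, h]
  have : P (⋃ i, {ω | Z ω = v i}) = 1 := by
    rw [measureReal_def] at hU
    exact (ENNReal.toReal_eq_one_iff _).1 hU
  have h2 := (prob_compl_eq_zero_iff (MeasurableSet.iUnion hm)).2 this
  filter_upwards [measure_eq_zero_iff_ae_notMem.1 h2] with ω hω
  simpa using hω

lemma integral_comp_eq_sum_of_sum_eq_one {Z : Ω → E} (hZ : Measurable Z) {v : ι → E}
    (hv : Function.Injective v) (h : ∑ i, P.real {ω | Z ω = v i} = 1) (g : E → ℝ) :
    ∫ ω, g (Z ω) ∂P = ∑ i, P.real {ω | Z ω = v i} * g (v i) := by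
  have hm : ∀ i, MeasurableSet {ω | Z ω = v i} := fun i => hZ (measurableSet_singleton (v i))
  have h1 : ∀ᵐ ω ∂P, g (Z ω) = ∑ i, {ω | Z ω = v i}.indicator (fun _ => g (v i)) ω := by
    filter_upwards [ae_exists_eq_of_sum_eq_one hZ hv h] with ω ⟨i, hi⟩
    rw [Finset.sum_eq_single i, Set.indicator_of_mem (by exact hi), hi]
    · intro j _ hj
      exact Set.indicator_of_notMem (fun h : Z ω = v j => hj (hv (h ▸ hi))) _
    · simp
  rw [integral_congr_ae h1, integral_finsetSum _ fun i _ =>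
    (integrable_const _).indicator (hm i)]
  refine Finset.sum_congr rfl fun i _ => ?_
  rw [integral_indicator_const _ (hm i), smul_eq_mul]

end General

/-! ### The signed shifts and signed basis vectors. -/

instance matrixMeasurableSingletonClass (d : ℕ) :
    MeasurableSingletonClass (Matrix (Fin d) (Fin d) ℝ) :=
  inferInstanceAs (MeasurableSingletonClass (Fin d → Fin d → ℝ))

lemma measurable_matrix_apply {d : ℕ} (i j : Fin d) :
    Measurable fun B : Matrix (Fin d) (Fin d) ℝ => B i j :=
  (measurable_pi_apply j).comp (measurable_pi_apply (X := fun _ : Fin d => Fin d → ℝ) i)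

lemma cyclicShift_pow_apply {d : ℕ} (k : ℕ) (i j : Fin d) :
    (cyclicShift d ^ k) i j = if (j : ℕ) = (i + k) % d then 1 else 0 := by
  induction k generalizing i with
  | zero =>
    simp [Matrix.one_apply, Nat.mod_eq_of_lt i.2, Fin.ext_iff, eq_comm]
  | succ k ih =>
    have hd : 0 < d := i.pos
    rw [pow_succ', Matrix.mul_apply,
      Finset.sum_eq_single (⟨((i : ℕ) + 1) % d, Nat.mod_lt _ hd⟩ : Fin d)]
    · rw [ih]
      simp only [cyclicShift, Matrix.of_apply, if_true, one_mul, Nat.mod_add_mod]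
      congr 2
      ring_nf
    · intro l _ hl
      have : ¬ (l : ℕ) = ((i : ℕ) + 1) % d := fun h => hl (Fin.ext h)
      simp [cyclicShift, this]
    · simp

/-- The `2d` matrices `±I_d, ±J_d, …, ±J_d^{d-1}`. -/
def signedShift (d : ℕ) (b : Bool × Fin d) : Matrix (Fin d) (Fin d) ℝ :=
  if b.1 then cyclicShift d ^ (b.2 : ℕ) else -cyclicShift d ^ (b.2 : ℕ)

lemma signedShift_apply {d : ℕ} (b : Bool × Fin d) (i j : Fin d) :
    signedShift d b i j =
      (if b.1 then 1 else -1) * if (j : ℕ) = (i + b.2) % d then (1 : ℝ) else 0 := by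
  rcases b with ⟨b, k⟩
  cases b <;> simp [signedShift, cyclicShift_pow_apply, neg_ite]

lemma signedShift_injective (d : ℕ) : Function.Injective (signedShift d) := by
  rintro ⟨b, k⟩ ⟨b', k'⟩ h
  -- Row `0` of `±J_d^k` has its only nonzero entry in column `k`, so this entry detects both
  -- exponent and sign.
  have h1 := congrFun (congrFun h ⟨0, k.pos⟩) k
  simp only [signedShift_apply, zero_add, Nat.mod_eq_of_lt k.2, Nat.mod_eq_of_lt k'.2,
    if_true] at h1
  by_cases hk : k = k'
  · subst hk
    cases b <;> cases b' <;> simp_all <;> norm_num at h1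
  · have : ¬ (k : ℕ) = k' := fun h => hk (Fin.ext h)
    cases b <;> cases b' <;> norm_num [this] at h1

/-- Each row has a single nonzero entry `±1`. This propagates the coordinate bound from `X_1` to all
steps. -/
lemma abs_sum_signedShift_mul_le {d : ℕ} (b : Bool × Fin d) (x : Fin d → ℝ)
    (hx : ∀ j, |x j| ≤ 1) (i : Fin d) : |∑ j, signedShift d b i j * x j| ≤ 1 := by
  rw [Finset.sum_eq_single (⟨((i : ℕ) + b.2) % d, Nat.mod_lt _ i.pos⟩ : Fin d)]
  · rw [signedShift_apply, abs_mul]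
    rcases b with ⟨b, k⟩
    cases b <;> simpa using hx _
  · intro l _ hl
    have : ¬ (l : ℕ) = ((i : ℕ) + b.2) % d := fun h => hl (Fin.ext h)
    simp [signedShift_apply, this]
  · simp

/-- The `2d` unit vectors `±e_i`. -/
def signedBasis (d : ℕ) (b : Bool × Fin d) : EuclideanSpace ℝ (Fin d) :=
  if b.1 then EuclideanSpace.single b.2 1 else -EuclideanSpace.single b.2 1

lemma signedBasis_apply {d : ℕ} (b : Bool × Fin d) (i : Fin d) :
    signedBasis d b i = (if b.1 then 1 else -1) * if i = b.2 then (1 : ℝ) else 0 := by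
  rcases b with ⟨b, k⟩
  cases b <;> simp [signedBasis, neg_ite]

lemma signedBasis_injective (d : ℕ) : Function.Injective (signedBasis d) := by
  rintro ⟨b, k⟩ ⟨b', k'⟩ h
  have h1 := congrArg (fun x : EuclideanSpace ℝ (Fin d) => x k) h
  simp only [signedBasis_apply, if_true] at h1
  by_cases hk : k = k'
  · subst hk
    cases b <;> cases b' <;> simp_all <;> norm_num at h1
  · cases b <;> cases b' <;> norm_num [hk] at h1

/-! ### Laws and almost sure bounds of the walk's ingredients. -/

namespace IsMERWRandomSteps

variable {Ω : Type*} [MeasurableSpace Ω] {P : Measure Ω} {d : ℕ} {p : ℝ}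
  {X : ℕ → Ω → EuclideanSpace ℝ (Fin d)} {A : ℕ → Ω → Matrix (Fin d) (Fin d) ℝ}
  {β : ℕ → Ω → ℕ} {Y : ℕ → Ω → ℝ}

lemma measureReal_A (h : IsMERWRandomSteps P d p X A β Y) {n : ℕ} (hn : 1 ≤ n)
    (b : Bool × Fin d) : P.real {ω | A (n + 1) ω = signedShift d b} =
      if b.1 = true ∧ (b.2 : ℕ) = 0 then p else (1 - p) / (2 * d - 1) := by
  rcases b with ⟨b, k⟩
  have hk : (k : ℕ) ≠ 0 → (k : ℕ) ∈ Finset.Icc 1 (d - 1) := by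
    intro hk
    have := k.2
    rw [Finset.mem_Icc]
    omega
  cases b
  · by_cases hk0 : (k : ℕ) = 0
    · simpa [signedShift, hk0] using h.law_A_neg_id n hn
    · simpa [signedShift] using h.law_A_neg_pow n hn k (hk hk0)
  · by_cases hk0 : (k : ℕ) = 0
    · simpa [signedShift, hk0] using h.law_A_id n hn
    · simpa [signedShift, hk0] using h.law_A_pow n hn k (hk hk0)

/-- The law of `A_{n+1}` is a uniform weight on all `2d` matrices plus an excess at the identity;
the excess equals `(2dp - 1) / (2d - 1)`, that is, `γ`. -/
lemma sum_weights_mul (hd : 1 ≤ d) (p : ℝ) (g : Bool × Fin d → ℝ) :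
    ∑ b : Bool × Fin d,
      (if b.1 = true ∧ (b.2 : ℕ) = 0 then p else (1 - p) / (2 * d - 1)) * g b =
    (p - (1 - p) / (2 * d - 1)) * g (true, ⟨0, hd⟩) + (1 - p) / (2 * d - 1) * ∑ b, g b := by
  rw [Finset.mul_sum, ← sub_eq_iff_eq_add, ← Finset.sum_sub_distrib,
    Finset.sum_eq_single ((true, ⟨0, hd⟩) : Bool × Fin d)]
  · simp
    ring
  · rintro ⟨b, k⟩ _ hb
    have : ¬ (b = true ∧ (k : ℕ) = 0) := by
      rintro ⟨h1, h2⟩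
      exact hb (Prod.ext h1 (Fin.ext h2))
    simp only [this, if_false, sub_self]
  · simp

lemma sum_measureReal_A (h : IsMERWRandomSteps P d p X A β Y) (hd : 1 ≤ d) {n : ℕ} (hn : 1 ≤ n) :
    ∑ b, P.real {ω | A (n + 1) ω = signedShift d b} = 1 := by
  have h1 := sum_weights_mul hd p (fun _ => 1)
  simp only [mul_one] at h1
  simp_rw [h.measureReal_A hn]
  rw [h1]
  have : (1 : ℝ) ≤ d := by exact_mod_cast hd
  have h2 : (2 * d - 1 : ℝ) ≠ 0 := by linarith
  simp
  field_simp
  ring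

lemma ae_A [IsProbabilityMeasure P]
    (h : IsMERWRandomSteps P d p X A β Y) (hd : 1 ≤ d) {n : ℕ} (hn : 1 ≤ n) :
    ∀ᵐ ω ∂P, ∃ b, A (n + 1) ω = signedShift d b :=
  ae_exists_eq_of_sum_eq_one (h.measurable_A n hn) (signedShift_injective d)
    (h.sum_measureReal_A hd hn)

lemma integral_A [IsProbabilityMeasure P]
    (h : IsMERWRandomSteps P d p X A β Y) (hd : 1 ≤ d) {n : ℕ} (hn : 1 ≤ n)
    (i j : Fin d) :
    ∫ ω, A (n + 1) ω i j ∂P = if i = j then (2 * d * p - 1) / (2 * d - 1) else 0 := by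
  rw [integral_comp_eq_sum_of_sum_eq_one (h.measurable_A n hn) (signedShift_injective d)
    (h.sum_measureReal_A hd hn) (fun B => B i j)]
  simp_rw [h.measureReal_A hn]
  rw [sum_weights_mul hd p (fun b => signedShift d b i j)]
  -- Opposite signs cancel, so only the excess at the identity contributes.
  have h0 : ∑ b, signedShift d b i j = 0 := by
    rw [Fintype.sum_prod_type, Fintype.sum_bool, ← Finset.sum_add_distrib]
    exact Finset.sum_eq_zero fun k _ => by simp [signedShift]
  have : (1 : ℝ) ≤ d := by exact_mod_cast hd
  have h2 : (2 * d - 1 : ℝ) ≠ 0 := by linarith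
  rw [h0, signedShift_apply]
  by_cases hij : i = j
  · subst hij
    simp [Nat.mod_eq_of_lt i.2]
    field_simp
    ring
  · have : ¬ (j : ℕ) = i := fun h => hij (Fin.ext h.symm)
    simp [Nat.mod_eq_of_lt i.2, this, hij]

lemma measureReal_X_one (h : IsMERWRandomSteps P d p X A β Y) (b : Bool × Fin d) :
    P.real {ω | X 1 ω = signedBasis d b} = 1 / (2 * d) := by
  rcases b with ⟨b, k⟩
  cases b
  · exact h.first_neg k
  · exact h.first_pos k

lemma ae_X_one [IsProbabilityMeasure P] (h : IsMERWRandomSteps P d p X A β Y) (hd : 1 ≤ d) :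
    ∀ᵐ ω ∂P, ∃ b, X 1 ω = signedBasis d b := by
  refine ae_exists_eq_of_sum_eq_one (h.measurable_X 1 le_rfl) (signedBasis_injective d) ?_
  simp_rw [h.measureReal_X_one]
  have : (d : ℝ) ≠ 0 := by positivity
  simp
  field_simp

lemma ae_β [IsProbabilityMeasure P] (h : IsMERWRandomSteps P d p X A β Y) {n : ℕ} (hn : 1 ≤ n) :
    ∀ᵐ ω ∂P, β n ω ∈ Finset.Icc 1 n := by
  have h1 := ae_exists_eq_of_sum_eq_one (P := P) (h.measurable_β n hn)
    (v := fun k : Finset.Icc 1 n => (k : ℕ)) Subtype.val_injective ?_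
  · filter_upwards [h1] with ω ⟨k, hk⟩
    rw [hk]
    exact k.2
  · have hk : ∀ k : Finset.Icc 1 n, P.real {ω | β n ω = (k : ℕ)} = 1 / n :=
      fun k => h.law_β n hn k k.2
    simp_rw [hk]
    have : (n : ℝ) ≠ 0 := by positivity
    simp
    field_simp

lemma ae_X_succ_apply (h : IsMERWRandomSteps P d p X A β Y) {n : ℕ} (hn : 1 ≤ n) :
    ∀ᵐ ω ∂P, ∀ i, X (n + 1) ω i = ∑ j, A (n + 1) ω i j * X (β n ω) ω j := by
  filter_upwards [h.step n hn] with ω hω i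
  rw [hω]
  simp [Matrix.toEuclideanLin, Matrix.mulVec, dotProduct]

lemma ae_abs_X_le_one [IsProbabilityMeasure P]
    (h : IsMERWRandomSteps P d p X A β Y) (hd : 1 ≤ d) {k : ℕ} (hk : 1 ≤ k) :
    ∀ᵐ ω ∂P, ∀ i, |X k ω i| ≤ 1 := by
  induction k using Nat.strong_induction_on with
  | _ k ih =>
    rcases eq_or_lt_of_le hk with rfl | hk1
    · filter_upwards [h.ae_X_one hd] with ω ⟨b, hb⟩ i
      rw [hb, signedBasis_apply]
      split_ifs <;> norm_num
    · obtain ⟨n, rfl⟩ : ∃ n, k = n + 1 := ⟨k - 1, by omega⟩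
      have hn : 1 ≤ n := by omega
      have hall : ∀ᵐ ω ∂P, ∀ k ∈ Finset.Icc 1 n, ∀ i, |X k ω i| ≤ 1 :=
        (Finset.eventually_all _).2 fun k hk => by
          rw [Finset.mem_Icc] at hk
          exact ih k (by omega) hk.1
      filter_upwards [h.ae_X_succ_apply hn, h.ae_A hd hn, h.ae_β hn, hall]
        with ω h1 ⟨b, hb⟩ h2 h3 i
      rw [h1, hb]
      exact abs_sum_signedShift_mul_le b _ (h3 _ h2) i

lemma ae_abs_A_le_one [IsProbabilityMeasure P]
    (h : IsMERWRandomSteps P d p X A β Y) (hd : 1 ≤ d) {n : ℕ} (hn : 1 ≤ n) :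
    ∀ᵐ ω ∂P, ∀ i j, |A (n + 1) ω i j| ≤ 1 := by
  filter_upwards [h.ae_A hd hn] with ω ⟨b, hb⟩ i j
  rw [hb, signedShift_apply]
  split_ifs <;> norm_num

lemma measurable_X_apply (h : IsMERWRandomSteps P d p X A β Y) {k : ℕ} (hk : 1 ≤ k)
    (i : Fin d) : Measurable fun ω => X k ω i := by
  have := h.measurable_X k hk
  fun_prop

lemma integrable_X [IsProbabilityMeasure P]
    (h : IsMERWRandomSteps P d p X A β Y) (hd : 1 ≤ d) {k : ℕ} (hk : 1 ≤ k)
    (i : Fin d) : Integrable (fun ω => X k ω i) P :=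
  Integrable.of_bound (h.measurable_X_apply hk i).aestronglyMeasurable 1
    ((h.ae_abs_X_le_one hd hk).mono fun _ hω => hω i)

/-! ### The history and the one-step conditional mean. -/

/-- The history of the walk up to time `n + 1`. -/
def history (h : IsMERWRandomSteps P d p X A β Y) : Filtration ℕ ‹MeasurableSpace Ω› where
  seq n := MeasurableSpace.comap (fun ω (k : Finset.Icc 1 (n + 1)) => (X k ω, Y k ω))
    MeasurableSpace.pi
  mono' := by
    intro n m hnm
    have hsub : ∀ k : Finset.Icc 1 (n + 1), (k : ℕ) ∈ Finset.Icc 1 (m + 1) := fun k => by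
      have := Finset.mem_Icc.1 k.2
      exact Finset.mem_Icc.2 ⟨this.1, by omega⟩
    have hg : Measurable fun (z : Finset.Icc 1 (m + 1) → EuclideanSpace ℝ (Fin d) × ℝ)
        (k : Finset.Icc 1 (n + 1)) => z ⟨k, hsub k⟩ := by fun_prop
    change MeasurableSpace.comap ((fun (z : Finset.Icc 1 (m + 1) → EuclideanSpace ℝ (Fin d) × ℝ)
        (k : Finset.Icc 1 (n + 1)) => z ⟨k, hsub k⟩) ∘
          fun ω (k : Finset.Icc 1 (m + 1)) => (X k ω, Y k ω)) MeasurableSpace.pi ≤ _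
    rw [← MeasurableSpace.comap_comp]
    exact MeasurableSpace.comap_mono hg.comap_le
  le' n := by
    refine Measurable.comap_le (measurable_pi_lambda _ fun k => ?_)
    have hk := (Finset.mem_Icc.1 k.2).1
    exact (h.measurable_X k hk).prodMk (h.measurable_Y k hk)

lemma measurable_pair_history (h : IsMERWRandomSteps P d p X A β Y) {n k : ℕ} (hk : 1 ≤ k)
    (hkn : k ≤ n + 1) : Measurable[h.history n] fun ω => (X k ω, Y k ω) := by
  have h1 : Measurable[h.history n]
      (fun ω (k : Finset.Icc 1 (n + 1)) => (X k ω, Y k ω)) := comap_measurable _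
  exact (measurable_pi_apply (⟨k, Finset.mem_Icc.2 ⟨hk, hkn⟩⟩ : Finset.Icc 1 (n + 1))).comp h1

lemma measurable_X_history (h : IsMERWRandomSteps P d p X A β Y) {n k : ℕ} (hk : 1 ≤ k)
    (hkn : k ≤ n + 1) (i : Fin d) : Measurable[h.history n] fun ω => X k ω i := by
  have h1 : Measurable fun z : EuclideanSpace ℝ (Fin d) × ℝ => z.1 i := by fun_prop
  exact h1.comp (h.measurable_pair_history hk hkn)

lemma measurable_Y_history (h : IsMERWRandomSteps P d p X A β Y) {n k : ℕ} (hk : 1 ≤ k)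
    (hkn : k ≤ n + 1) : Measurable[h.history n] (Y k) :=
  measurable_snd.comp (h.measurable_pair_history hk hkn)

lemma integral_indicator_β_mul (h : IsMERWRandomSteps P d p X A β Y) {n : ℕ} (hn : 1 ≤ n)
    {k : ℕ} (hk : k ∈ Finset.Icc 1 n) {g : ℝ → ℝ} (hg : Measurable g) :
    ∫ ω, (if β n ω = k then 1 else 0) * g (Y (n + 1) ω) ∂P =
      1 / n * ∫ ω, g (Y (n + 1) ω) ∂P := by
  have hβ : Measurable fun l : ℕ => if l = k then (1 : ℝ) else 0 := measurable_of_countable _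
  rw [(h.indep_β_Y n hn).integral_fun_comp_mul_comp (f := fun l => if l = k then (1 : ℝ) else 0)
    (h.measurable_β n hn).aemeasurable (h.measurable_Y _ (by omega)).aemeasurable
    hβ.aestronglyMeasurable hg.aestronglyMeasurable, ← h.law_β n hn k hk]
  congr 1
  have hm : MeasurableSet {ω | β n ω = k} := h.measurable_β n hn (measurableSet_singleton k)
  rw [← mul_one (P.real _), ← smul_eq_mul, ← integral_indicator_const (1 : ℝ) hm]
  exact integral_congr_ae (ae_of_all _ fun ω => by simp [Set.indicator_apply])

/-- The conditional expectation of `g(Y_{n+1}) X_{n+1}` given the past, in integrated form. -/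
lemma setIntegral_mul_X_succ [IsProbabilityMeasure P]
    (h : IsMERWRandomSteps P d p X A β Y) (hd : 1 ≤ d) (n : ℕ)
    {s : Set Ω} (hs : MeasurableSet[h.history n] s) {g : ℝ → ℝ} (hg : Measurable g)
    (hint : Integrable (fun ω => g (Y (n + 2) ω)) P) (i : Fin d) :
    ∫ ω in s, g (Y (n + 2) ω) * X (n + 2) ω i ∂P =
      (∫ ω, g (Y (n + 2) ω) ∂P) * ((2 * d * p - 1) / (2 * d - 1) / (n + 1)) *
        ∫ ω in s, ∑ k ∈ Finset.Icc 1 (n + 1), X k ω i ∂P := by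
  have hn : 1 ≤ n + 1 := by omega
  have hsm : MeasurableSet s := h.history.le n s hs
  obtain ⟨T, hT, rfl⟩ := hs
  set past : Ω → (Finset.Icc 1 (n + 1) → EuclideanSpace ℝ (Fin d) × ℝ) :=
    fun ω k => (X k ω, Y k ω) with hpast
  -- Splitting over the value `k` of `β` and the column `j` makes each term a product of an
  -- innovation factor `U` and a past factor `V`, which are independent.
  set U : ℕ → Fin d → Ω → ℝ := fun k j ω =>
    A (n + 2) ω i j * ((if β (n + 1) ω = k then 1 else 0) * g (Y (n + 2) ω)) with hU
  set V : ℕ → Fin d → Ω → ℝ := fun k j ω => (past ⁻¹' T).indicator (fun ω => X k ω j) ω with hV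
  have hβ : ∀ k : ℕ, Measurable fun l : ℕ => if l = k then (1 : ℝ) else 0 :=
    fun k => measurable_of_countable _
  have hUint : ∀ k j, Integrable (U k j) P := by
    intro k j
    have hA := h.measurable_A (n + 1) hn
    refine hint.mono ?_ ?_
    · exact (((measurable_matrix_apply i j).comp hA).mul (((hβ k).comp
        (h.measurable_β (n + 1) hn)).mul (hg.comp (h.measurable_Y _ (by omega))))).aestronglyMeasurable
    · filter_upwards [h.ae_abs_A_le_one hd hn] with ω hω
      have h1 := hω i j
      simp only [hU, norm_mul, Real.norm_eq_abs]
      have h2 : |if β (n + 1) ω = k then (1 : ℝ) else 0| ≤ 1 := by split_ifs <;> norm_num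
      calc |A (n + 2) ω i j| * (|if β (n + 1) ω = k then (1 : ℝ) else 0| * |g (Y (n + 2) ω)|)
          ≤ 1 * (1 * |g (Y (n + 2) ω)|) := by gcongr
        _ = |g (Y (n + 2) ω)| := by ring
  have hVint : ∀ k ∈ Finset.Icc 1 (n + 1), ∀ j, Integrable (V k j) P := fun k hk j =>
    (h.integrable_X hd (Finset.mem_Icc.1 hk).1 j).indicator hsm
  have hindep : ∀ k ∈ Finset.Icc 1 (n + 1), ∀ j, IndepFun (U k j) (V k j) P := by
    intro k hk j
    have h1 : Measurable fun z : Matrix (Fin d) (Fin d) ℝ × ℕ × ℝ =>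
        z.1 i j * ((if z.2.1 = k then 1 else 0) * g z.2.2) :=
      ((measurable_matrix_apply i j).comp measurable_fst).mul
        (((hβ k).comp (measurable_fst.comp measurable_snd)).mul
          (hg.comp (measurable_snd.comp measurable_snd)))
    have h2 : Measurable (T.indicator
        fun z : Finset.Icc 1 (n + 1) → EuclideanSpace ℝ (Fin d) × ℝ => (z ⟨k, hk⟩).1 j) := by
      refine Measurable.indicator ?_ hT
      fun_prop
    exact (h.indep_past (n + 1) hn).comp h1 h2
  have hUval : ∀ k ∈ Finset.Icc 1 (n + 1), ∀ j, ∫ ω, U k j ω ∂P =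
      (if i = j then (2 * d * p - 1) / (2 * d - 1) else 0) *
        (1 / ((n + 1 : ℕ) : ℝ) * ∫ ω, g (Y (n + 2) ω) ∂P) := by
    intro k hk j
    have h1 : Measurable fun z : ℕ × ℝ => (if z.1 = k then 1 else 0) * g z.2 :=
      ((hβ k).comp measurable_fst).mul (hg.comp measurable_snd)
    rw [← h.integral_A hd hn i j, ← h.integral_indicator_β_mul hn hk hg]
    exact (h.indep_A (n + 1) hn).integral_fun_comp_mul_comp
      (f := fun B : Matrix (Fin d) (Fin d) ℝ => B i j)
      (g := fun z : ℕ × ℝ => (if z.1 = k then 1 else 0) * g z.2)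
      (h.measurable_A (n + 1) hn).aemeasurable
      ((h.measurable_β (n + 1) hn).prodMk (h.measurable_Y _ (by omega))).aemeasurable
      (measurable_matrix_apply i j).aestronglyMeasurable h1.aestronglyMeasurable
  have hUV : ∀ k ∈ Finset.Icc 1 (n + 1), ∀ j, Integrable (fun ω => U k j ω * V k j ω) P :=
    fun k hk j => (hindep k hk j).integrable_mul (hUint k j) (hVint k hk j)
  have hexp : ∀ᵐ ω ∂P, (past ⁻¹' T).indicator (fun ω => g (Y (n + 2) ω) * X (n + 2) ω i) ω =
      ∑ k ∈ Finset.Icc 1 (n + 1), ∑ j, U k j ω * V k j ω := by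
    -- Only the term with `k` equal to the realized value of `β` survives.
    filter_upwards [h.ae_X_succ_apply hn, h.ae_β hn] with ω h1 h2
    rw [Finset.sum_eq_single_of_mem _ h2]
    · by_cases hω : ω ∈ past ⁻¹' T
      · simp only [hU, hV, Set.indicator_of_mem hω, if_true, one_mul]
        rw [h1, Finset.mul_sum]
        exact Finset.sum_congr rfl fun j _ => by ring
      · simp [hV, Set.indicator_of_notMem hω]
    · intro k _ hk
      exact Finset.sum_eq_zero fun j _ => by simp [hU, hk.symm]
  rw [← integral_indicator hsm, integral_congr_ae hexp,
    integral_finsetSum _ fun k hk => integrable_finsetSum _ fun j _ => hUV k hk j,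
    integral_finsetSum _ fun k hk =>
      (h.integrable_X hd (Finset.mem_Icc.1 hk).1 i).integrableOn, Finset.mul_sum]
  refine Finset.sum_congr rfl fun k hk => ?_
  rw [integral_finsetSum _ fun j _ => hUV k hk j, Finset.sum_eq_single_of_mem i (Finset.mem_univ _)]
  · rw [(hindep k hk i).integral_fun_mul_eq_mul_integral (hUint k i).1 (hVint k hk i).1,
      hUval k hk, if_pos rfl, ← integral_indicator hsm]
    push_cast
    ring
  · intro j _ hj
    rw [(hindep k hk j).integral_fun_mul_eq_mul_integral (hUint k j).1 (hVint k hk j).1,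
      hUval k hk, if_neg hj.symm]
    simp

lemma sum_Icc_succ_eq (f : ℕ → ℝ) (n : ℕ) :
    ∑ k ∈ Finset.Icc 1 (n + 2), f k = ∑ k ∈ Finset.Icc 1 (n + 1), f k + f (n + 2) :=
  Finset.sum_Icc_succ_top (by omega) f

lemma ae_abs_sum_le (h : IsMERWRandomSteps P d p X A β Y) [IsProbabilityMeasure P] (hd : 1 ≤ d)
    (n : ℕ) : ∀ᵐ ω ∂P, ∀ i, |∑ k ∈ Finset.Icc 1 n, X k ω i| ≤ n := by
  have hall : ∀ᵐ ω ∂P, ∀ k ∈ Finset.Icc 1 n, ∀ i, |X k ω i| ≤ 1 :=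
    (Finset.eventually_all _).2 fun k hk => h.ae_abs_X_le_one hd (Finset.mem_Icc.1 hk).1
  filter_upwards [hall] with ω hω i
  refine (Finset.abs_sum_le_sum_abs _ _).trans
    ((Finset.sum_le_sum fun k hk => hω k hk i).trans ?_)
  simp

/-! ### The martingale of the normalized walk. -/

/-- The normalized coordinates of the walk. -/
def normalizedWalk (γ : ℝ) (X : ℕ → Ω → EuclideanSpace ℝ (Fin d)) (i : Fin d) (n : ℕ)
    (ω : Ω) : ℝ :=
  merwNormalizer γ n * ∑ k ∈ Finset.Icc 1 (n + 1), X k ω i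

lemma measurable_sum_X_history (h : IsMERWRandomSteps P d p X A β Y) (n : ℕ) (i : Fin d) :
    Measurable[h.history n] fun ω => ∑ k ∈ Finset.Icc 1 (n + 1), X k ω i :=
  Finset.measurable_fun_sum _ fun _ hk =>
    h.measurable_X_history (Finset.mem_Icc.1 hk).1 (Finset.mem_Icc.1 hk).2 i

lemma memLp_normalizedWalk [IsProbabilityMeasure P]
    (h : IsMERWRandomSteps P d p X A β Y) (hd : 1 ≤ d) (γ : ℝ)
    (i : Fin d) (n : ℕ) : MemLp (normalizedWalk γ X i n) 2 P := by
  refine MemLp.const_mul (MemLp.of_bound (C := (n + 1 : ℕ))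
    ((h.measurable_sum_X_history n i).mono (h.history.le n) le_rfl).aestronglyMeasurable ?_) _
  exact (h.ae_abs_sum_le hd (n + 1)).mono fun ω hω => hω i

/-- Taking `g = 1` in `setIntegral_mul_X_succ`, one step multiplies the conditional mean of the walk
by `1 + γ / (n + 1)`, which the normalizer absorbs. -/
lemma martingale_normalizedWalk [IsProbabilityMeasure P]
    (h : IsMERWRandomSteps P d p X A β Y) (hd : 1 ≤ d) {γ : ℝ}
    (hγ : γ = (2 * d * p - 1) / (2 * d - 1)) (hγ0 : 0 < γ) (i : Fin d) :
    Martingale (normalizedWalk γ X i) h.history P := by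
  refine martingale_of_setIntegral_eq_succ
    (fun n => ((h.measurable_sum_X_history n i).const_mul _).stronglyMeasurable)
    (fun n => (h.memLp_normalizedWalk hd γ i n).integrable one_le_two) fun n s hs => ?_
  have hkey := h.setIntegral_mul_X_succ hd n hs (g := fun _ => 1) measurable_const
    (integrable_const _) i
  simp only [one_mul, integral_const, probReal_univ, smul_eq_mul, ← hγ] at hkey
  have hsum : Integrable (fun ω => ∑ k ∈ Finset.Icc 1 (n + 1), X k ω i) P :=
    integrable_finsetSum _ fun k hk => h.integrable_X hd (Finset.mem_Icc.1 hk).1 i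
  simp only [normalizedWalk]
  simp_rw [sum_Icc_succ_eq (fun k => X k _ i)]
  rw [integral_const_mul, integral_const_mul, integral_add hsum.integrableOn
    (h.integrable_X hd (by omega) i).integrableOn, hkey, ← merwNormalizer_succ_mul hγ0 n]
  ring

lemma uniformIntegrable_normalizedWalk [IsProbabilityMeasure P]
    (h : IsMERWRandomSteps P d p X A β Y) (hd : 1 ≤ d)
    {γ : ℝ} (hγ : γ = (2 * d * p - 1) / (2 * d - 1)) (hγ2 : 1 / 2 < γ) (i : Fin d) :
    UniformIntegrable (normalizedWalk γ X i) 1 P := by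
  have hγ0 : 0 < γ := by linarith
  have hs : Summable fun n => ((1 + γ) * merwNormalizer γ (n + 1)) ^ 2 := by
    simp_rw [mul_pow]
    exact ((summable_nat_add_iff 1).2 (summable_sq_merwNormalizer hγ2)).mul_left _
  refine uniformIntegrable_martingale_of_summable (h.martingale_normalizedWalk hd hγ hγ0 i)
    (h.memLp_normalizedWalk hd γ i) (fun n => ?_) hs
  have hb : ∀ᵐ ω ∂P, (normalizedWalk γ X i (n + 1) ω - normalizedWalk γ X i n ω) ^ 2 ≤
      ((1 + γ) * merwNormalizer γ (n + 1)) ^ 2 := by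
    filter_upwards [h.ae_abs_sum_le hd (n + 1), h.ae_abs_X_le_one hd (k := n + 2) (by omega)]
      with ω h1 h2
    have h1 := h1 i
    have h2 := h2 i
    set w := ∑ k ∈ Finset.Icc 1 (n + 1), X k ω i with hw
    -- The increment is the normalizer times `X_{n+2}` minus its conditional mean, hence the bound
    -- `1 + γ` on the second factor.
    have hdiff : normalizedWalk γ X i (n + 1) ω - normalizedWalk γ X i n ω =
        merwNormalizer γ (n + 1) * (X (n + 2) ω i - γ * (w / (n + 1))) := by
      simp only [normalizedWalk]
      rw [sum_Icc_succ_eq (fun k => X k ω i), ← merwNormalizer_succ_mul hγ0 n, ← hw]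
      ring
    have h3 : |w / (n + 1)| ≤ 1 := by
      have hn : (0 : ℝ) < n + 1 := by positivity
      rw [abs_div, abs_of_pos hn, div_le_one hn]
      exact_mod_cast h1
    have h4 : |X (n + 2) ω i - γ * (w / (n + 1))| ≤ 1 + γ := by
      refine (abs_sub _ _).trans ?_
      rw [abs_mul, abs_of_pos hγ0]
      have := mul_le_mul_of_nonneg_left h3 hγ0.le
      linarith
    have h5 := merwNormalizer_pos hγ0 (n + 1)
    rw [hdiff, mul_comm, mul_pow, mul_pow, ← sq_abs (X (n + 2) ω i - _)]
    gcongr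
  refine (integral_mono_ae ?_ (integrable_const _) hb).trans (by simp)
  exact ((h.memLp_normalizedWalk hd γ i (n + 1)).sub
    (h.memLp_normalizedWalk hd γ i n)).integrable_sq

/-! ### Fluctuations of the step sizes. -/

/-- The coordinates of `∑ (Y_k - μ) X_k / (k - 1)^γ`. -/
def weightedFluctuation (γ μ : ℝ) (X : ℕ → Ω → EuclideanSpace ℝ (Fin d)) (Y : ℕ → Ω → ℝ)
    (i : Fin d) (n : ℕ) (ω : Ω) : ℝ :=
  ∑ k ∈ Finset.range n, (((k : ℝ) + 1) ^ γ)⁻¹ * ((Y (k + 2) ω - μ) * X (k + 2) ω i)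

lemma memLp_fluctuation [IsProbabilityMeasure P]
    (h : IsMERWRandomSteps P d p X A β Y) (hd : 1 ≤ d) (μ : ℝ) (i : Fin d)
    (k : ℕ) : MemLp (fun ω => (Y (k + 2) ω - μ) * X (k + 2) ω i) 2 P := by
  have h1 : MemLp (fun ω => Y (k + 2) ω - μ) 2 P :=
    (h.memLp_Y (k + 2) (by omega)).sub (memLp_const μ)
  refine h1.mono (h1.1.mul (h.measurable_X_apply (by omega) i).aestronglyMeasurable) ?_
  filter_upwards [h.ae_abs_X_le_one hd (k := k + 2) (by omega)] with ω hω
  rw [norm_mul]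
  exact mul_le_of_le_one_right (norm_nonneg _) (hω i)

lemma memLp_weightedFluctuation [IsProbabilityMeasure P]
    (h : IsMERWRandomSteps P d p X A β Y) (hd : 1 ≤ d) (γ μ : ℝ)
    (i : Fin d) (n : ℕ) : MemLp (weightedFluctuation γ μ X Y i n) 2 P :=
  memLp_finsetSum _ fun k _ => (h.memLp_fluctuation hd μ i k).const_mul _

lemma measurable_weightedFluctuation (h : IsMERWRandomSteps P d p X A β Y) (γ μ : ℝ)
    (i : Fin d) (n : ℕ) : Measurable[h.history n] (weightedFluctuation γ μ X Y i n) := by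
  refine Finset.measurable_fun_sum _ fun k hk => ?_
  have hk := Finset.mem_range.1 hk
  exact (((h.measurable_Y_history (by omega) (by omega)).sub_const μ).mul
    (h.measurable_X_history (by omega) (by omega) i)).const_mul _

/-- With `g y = y - μ`, the mean of `g (Y (n + 2))` vanishes, and with it the conditional mean of
the increment. -/
lemma martingale_weightedFluctuation [IsProbabilityMeasure P]
    (h : IsMERWRandomSteps P d p X A β Y) (hd : 1 ≤ d)
    (γ : ℝ) {μ : ℝ} (hμ : μ = ∫ ω, Y 2 ω ∂P) (i : Fin d) :
    Martingale (weightedFluctuation γ μ X Y i) h.history P := by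
  refine martingale_of_setIntegral_eq_succ
    (fun n => (h.measurable_weightedFluctuation γ μ i n).stronglyMeasurable)
    (fun n => (h.memLp_weightedFluctuation hd γ μ i n).integrable one_le_two) fun n s hs => ?_
  have hY : Integrable (Y (n + 2)) P := (h.memLp_Y (n + 2) (by omega)).integrable one_le_two
  have hkey := h.setIntegral_mul_X_succ hd n hs (g := fun y => y - μ) (by fun_prop)
    (hY.sub (integrable_const _)) i
  have h0 : ∫ ω, (Y (n + 2) ω - μ) ∂P = 0 := by
    rw [integral_sub hY (integrable_const _), (h.identDistrib_Y (n + 2) (by omega)).integral_eq,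
      ← hμ]
    simp
  rw [h0, zero_mul, zero_mul] at hkey
  simp only [weightedFluctuation, Finset.sum_range_succ _ n]
  rw [integral_add, integral_const_mul, hkey, mul_zero, add_zero]
  · exact ((h.memLp_weightedFluctuation hd γ μ i n).integrable one_le_two).integrableOn
  · exact (((h.memLp_fluctuation hd μ i n).integrable one_le_two).const_mul _).integrableOn

/-- Since `|X| ≤ 1` coordinatewise, the increments have second moment at most the variance of `Y 2`
times `(n + 1)^{-2γ}`, summable as `2γ > 1`. -/
lemma uniformIntegrable_weightedFluctuation [IsProbabilityMeasure P]
    (h : IsMERWRandomSteps P d p X A β Y) (hd : 1 ≤ d)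
    {γ : ℝ} (hγ : 1 / 2 < γ) {μ : ℝ} (hμ : μ = ∫ ω, Y 2 ω ∂P) (i : Fin d) :
    UniformIntegrable (weightedFluctuation γ μ X Y i) 1 P := by
  have hs : Summable fun n : ℕ =>
      (((n : ℝ) + 1) ^ γ)⁻¹ ^ 2 * ∫ ω, (Y 2 ω - μ) ^ 2 ∂P := by
    refine Summable.mul_right _ (((summable_nat_add_iff 1).2
      (Real.summable_one_div_nat_rpow.2 (by linarith : 1 < 2 * γ))).congr fun n => ?_)
    push_cast
    rw [one_div, inv_pow, ← Real.rpow_natCast, ← Real.rpow_mul (by positivity), mul_comm γ]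
    simp
  refine uniformIntegrable_martingale_of_summable (h.martingale_weightedFluctuation hd γ hμ i)
    (h.memLp_weightedFluctuation hd γ μ i) (fun n => ?_) hs
  have h1 : MemLp (fun ω => Y (n + 2) ω - μ) 2 P :=
    (h.memLp_Y (n + 2) (by omega)).sub (memLp_const μ)
  have h2 : ∫ ω, (Y (n + 2) ω - μ) ^ 2 ∂P = ∫ ω, (Y 2 ω - μ) ^ 2 ∂P :=
    ((h.identDistrib_Y (n + 2) (by omega)).comp (u := fun y : ℝ => (y - μ) ^ 2)
      (by fun_prop)).integral_eq
  simp only [weightedFluctuation, Finset.sum_range_succ _ n, add_sub_cancel_left]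
  rw [← h2, ← integral_const_mul]
  refine integral_mono_ae ((h.memLp_fluctuation hd μ i n).const_mul _).integrable_sq
    (h1.integrable_sq.const_mul _) ?_
  filter_upwards [h.ae_abs_X_le_one hd (k := n + 2) (by omega)] with ω hω
  rw [mul_pow, mul_pow]
  have h3 : X (n + 2) ω i ^ 2 ≤ 1 := (sq_le_one_iff_abs_le_one _).2 (hω i)
  exact mul_le_mul_of_nonneg_left (mul_le_of_le_one_right (sq_nonneg _) h3) (by positivity)

lemma ae_tendsto_fluctuation [IsProbabilityMeasure P]
    (h : IsMERWRandomSteps P d p X A β Y) (hd : 1 ≤ d)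
    {γ : ℝ} (hγ : 1 / 2 < γ) {μ : ℝ} (hμ : μ = ∫ ω, Y 2 ω ∂P) (i : Fin d) :
    ∀ᵐ ω ∂P, Tendsto (fun n : ℕ => (∑ k ∈ Finset.range n, (Y (k + 2) ω - μ) * X (k + 2) ω i) /
      ((n : ℝ) + 1) ^ γ) atTop (𝓝 0) := by
  have hγ0 : 0 < γ := by linarith
  have hmart := h.martingale_weightedFluctuation hd γ hμ i
  filter_upwards [hmart.submartingale.ae_tendsto_limitProcess_of_uniformIntegrable
    (h.uniformIntegrable_weightedFluctuation hd hγ hμ i)] with ω hω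
  have hb : Monotone fun n : ℕ => ((n : ℝ) + 1) ^ γ := fun m n hmn => by
    have : (m : ℝ) ≤ n := by exact_mod_cast hmn
    simp only
    gcongr
  have hb_top : Tendsto (fun n : ℕ => ((n : ℝ) + 1) ^ γ) atTop atTop :=
    (tendsto_rpow_atTop hγ0).comp
      (tendsto_atTop_add_const_right _ _ tendsto_natCast_atTop_atTop)
  refine (tendsto_sum_div_of_tendsto_sum hb hb_top hω).congr fun n => ?_
  congr 1
  refine Finset.sum_congr rfl fun k _ => ?_
  rw [mul_inv_cancel_left₀ (by positivity)]

/-! ### The limit vector, convergence and non-degeneracy. -/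

/-- The limit of the normalized walk. -/
def limitVector (h : IsMERWRandomSteps P d p X A β Y) (γ : ℝ) (ω : Ω) :
    EuclideanSpace ℝ (Fin d) :=
  WithLp.toLp 2 fun i =>
    (Filtration.limitProcess (normalizedWalk γ X i) h.history P ω) / (γ * Real.Gamma γ)

lemma measurable_limitVector (h : IsMERWRandomSteps P d p X A β Y) (γ : ℝ) :
    Measurable (h.limitVector γ) :=
  (WithLp.measurable_toLp 2 _).comp (measurable_pi_lambda _ fun _ =>
    (Filtration.stronglyMeasurable_limit_process'.measurable).div_const _)

lemma ae_tendsto_sum_X [IsProbabilityMeasure P]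
    (h : IsMERWRandomSteps P d p X A β Y) (hd : 1 ≤ d) {γ : ℝ}
    (hγ : γ = (2 * d * p - 1) / (2 * d - 1)) (hγ2 : 1 / 2 < γ) (i : Fin d) :
    ∀ᵐ ω ∂P, Tendsto (fun n : ℕ => (((n : ℝ) + 1) ^ γ)⁻¹ * ∑ k ∈ Finset.Icc 1 (n + 1), X k ω i)
      atTop (𝓝 (h.limitVector γ ω i)) := by
  have hγ0 : 0 < γ := by linarith
  have hmart := h.martingale_normalizedWalk hd hγ hγ0 i
  filter_upwards [hmart.submartingale.ae_tendsto_limitProcess_of_uniformIntegrable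
    (h.uniformIntegrable_normalizedWalk hd hγ hγ2 i)] with ω hω
  have hg : γ * Real.Gamma γ ≠ 0 := (mul_pos hγ0 (Real.Gamma_pos_of_pos hγ0)).ne'
  refine (hω.div (tendsto_add_one_rpow_mul_merwNormalizer hγ0) hg).congr fun n => ?_
  have h1 := (merwNormalizer_pos hγ0 n).ne'
  have h2 : ((n : ℝ) + 1) ^ γ ≠ 0 := by positivity
  simp only [Pi.div_apply, normalizedWalk]
  field_simp

lemma ae_tendsto_sum_smul_X [IsProbabilityMeasure P]
    (h : IsMERWRandomSteps P d p X A β Y) (hd : 1 ≤ d) {γ : ℝ}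
    (hγ : γ = (2 * d * p - 1) / (2 * d - 1)) (hγ2 : 1 / 2 < γ) {μ : ℝ}
    (hμ : μ = ∫ ω, Y 2 ω ∂P) (i : Fin d) :
    ∀ᵐ ω ∂P, Tendsto
      (fun n : ℕ => (((n : ℝ) + 1) ^ γ)⁻¹ * ∑ k ∈ Finset.Icc 1 (n + 1), Y k ω * X k ω i)
      atTop (𝓝 (μ * h.limitVector γ ω i)) := by
  have hγ0 : 0 < γ := by linarith
  filter_upwards [h.ae_tendsto_sum_X hd hγ hγ2 i, h.ae_tendsto_fluctuation hd hγ2 hμ i]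
    with ω h1 h2
  -- The first step is split off because `Y 1` may have a different law; a single term is
  -- negligible.
  have h3 : Tendsto (fun n : ℕ => ((Y 1 ω - μ) * X 1 ω i) / ((n : ℝ) + 1) ^ γ) atTop (𝓝 0) :=
    ((tendsto_rpow_atTop hγ0).comp
      (tendsto_atTop_add_const_right _ _ tendsto_natCast_atTop_atTop)).const_div_atTop _
  have h4 := (h3.add h2).add (h1.const_mul μ)
  simp only [zero_add] at h4
  refine h4.congr fun n => ?_
  have hsum : ∑ k ∈ Finset.Icc 1 (n + 1), Y k ω * X k ω i =
      (Y 1 ω - μ) * X 1 ω i + ∑ k ∈ Finset.range n, (Y (k + 2) ω - μ) * X (k + 2) ω i +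
        μ * ∑ k ∈ Finset.Icc 1 (n + 1), X k ω i := by
    induction n with
    | zero => simp; ring
    | succ n ih =>
      rw [sum_Icc_succ_eq (fun k => Y k ω * X k ω i), sum_Icc_succ_eq (fun k => X k ω i), ih,
        Finset.sum_range_succ _ n]
      ring
  rw [hsum]
  ring

lemma isNondegenerate_limitVector [IsProbabilityMeasure P]
    (h : IsMERWRandomSteps P d p X A β Y) (hd : 1 ≤ d) {γ : ℝ}
    (hγ : γ = (2 * d * p - 1) / (2 * d - 1)) (hγ2 : 1 / 2 < γ) :
    IsNondegenerate P (h.limitVector γ) := by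
  intro u hu c hc
  have hγ0 : 0 < γ := by linarith
  have hg : γ * Real.Gamma γ ≠ 0 := (mul_pos hγ0 (Real.Gamma_pos_of_pos hγ0)).ne'
  set L : Fin d → Ω → ℝ := fun i => Filtration.limitProcess (normalizedWalk γ X i) h.history P with hL
  have hmart := fun i => h.martingale_normalizedWalk hd hγ hγ0 i
  have hUI := fun i => h.uniformIntegrable_normalizedWalk hd hγ hγ2 i
  have hLint : ∀ i, Integrable (L i) P := fun i =>
    (hUI i).integrable_of_ae_tendsto
      ((hmart i).submartingale.ae_tendsto_limitProcess_of_uniformIntegrable (hUI i))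
  have hconst : (∑ i, u i • L i) =ᵐ[P] fun _ => c * (γ * Real.Gamma γ) := by
    filter_upwards [hc] with ω hω
    rw [← hω, PiLp.inner_apply, Finset.sum_mul, Finset.sum_apply]
    refine Finset.sum_congr rfl fun i _ => ?_
    simp only [limitVector, hL, Pi.smul_apply, smul_eq_mul, RCLike.inner_apply, conj_trivial]
    field_simp
  have hcond : ∀ᵐ ω ∂P, ∑ i, u i * X 1 ω i = c * (γ * Real.Gamma γ) := by
    have h1 := condExp_finsetSum (μ := P) (s := Finset.univ) (f := fun i => u i • L i)
      (fun i _ => (hLint i).smul (u i)) (h.history 0)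
    have h2 := condExp_congr_ae (m := h.history 0) hconst
    rw [condExp_const (h.history.le 0)] at h2
    have h3 : ∀ᵐ ω ∂P, ∀ i, P[u i • L i | h.history 0] ω = u i * P[L i | h.history 0] ω :=
      ae_all_iff.2 fun i => condExp_smul (u i) (L i) (h.history 0)
    -- The limit closes the martingale; at index `0`, which is time `1`, the martingale is the
    -- coordinate of `X 1`.
    have h4 : ∀ᵐ ω ∂P, ∀ i, normalizedWalk γ X i 0 ω = P[L i | h.history 0] ω :=
      ae_all_iff.2 fun i => Martingale.ae_eq_condExp_limitProcess (hmart i) (hUI i) 0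
    filter_upwards [h1, h2, h3, h4] with ω h1 h2 h3 h4
    rw [← h2, h1, Finset.sum_apply]
    refine Finset.sum_congr rfl fun i _ => ?_
    rw [h3, ← h4]
    simp [normalizedWalk, merwNormalizer_zero]
  have hd0 : (0 : ℝ) < d := by exact_mod_cast hd
  have hval : ∀ b, ∑ i, u i * signedBasis d b i = c * (γ * Real.Gamma γ) := by
    intro b
    -- Each `±e_i` is an atom of the law of `X 1`, so the almost sure identity must hold there.
    have hne : P {ω | X 1 ω = signedBasis d b} ≠ 0 := by
      intro h0
      have h1 := h.measureReal_X_one b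
      rw [measureReal_def, h0] at h1
      have : (0 : ℝ) < 1 / (2 * d) := by positivity
      simp at h1
      linarith
    obtain ⟨ω, h1, h2⟩ := ((frequently_ae_iff.2 hne).and_eventually hcond).exists
    rw [← h1]
    exact h2
  refine hu (PiLp.ext fun j => ?_)
  -- The values at `e_j` and `-e_j` give `u j = -u j`.
  have h1 := hval (true, j)
  have h2 := hval (false, j)
  simp [signedBasis_apply] at h1 h2
  simp
  linarith

end IsMERWRandomSteps

/-! ### Assembly from coordinates. -/

lemma tendsto_euclidean_of_forall_succ {d : ℕ} {f : ℕ → EuclideanSpace ℝ (Fin d)}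
    {a : EuclideanSpace ℝ (Fin d)}
    (h : ∀ i, Tendsto (fun n => f (n + 1) i) atTop (𝓝 (a i))) : Tendsto f atTop (𝓝 a) := by
  rw [← tendsto_add_atTop_iff_nat 1]
  exact ((PiLp.continuous_toLp 2 (fun _ : Fin d => ℝ)).tendsto _).comp (tendsto_pi_nhds.2 h)

end

theorem mainTheorem8 {Ω : Type*} [MeasurableSpace Ω] (P : Measure Ω) [IsProbabilityMeasure P]
    (d : ℕ) (hd : 1 ≤ d) (p γ : ℝ) (hp : (2 * d + 1) / (4 * d) < p) (hp1 : p ≤ 1)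
    (hγ : γ = (2 * d * p - 1) / (2 * d - 1))
    (X : ℕ → Ω → EuclideanSpace ℝ (Fin d)) (A : ℕ → Ω → Matrix (Fin d) (Fin d) ℝ)
    (β : ℕ → Ω → ℕ) (Y : ℕ → Ω → ℝ) (μ : ℝ) (hμ : μ = ∫ ω, Y 2 ω ∂P)
    (hwalk : IsMERWRandomSteps P d p X A β Y) :
    ∃ S : Ω → EuclideanSpace ℝ (Fin d), Measurable S ∧ IsNondegenerate P S ∧
      (∀ᵐ ω ∂P, Tendsto (fun n : ℕ => ((n : ℝ) ^ γ)⁻¹ • merwPosition X n ω) atTop (𝓝 (S ω))) ∧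
      (∀ᵐ ω ∂P, Tendsto (fun n : ℕ => ((n : ℝ) ^ γ)⁻¹ • randomStepPosition X Y n ω) atTop
        (𝓝 (μ • S ω))) := by
  -- The lower bound on `p` is exactly the condition `γ > 1/2`.
  have hγ2 : 1 / 2 < γ := by
    have hd1 : (1 : ℝ) ≤ d := by exact_mod_cast hd
    rw [div_lt_iff₀ (by linarith)] at hp
    rw [hγ, lt_div_iff₀ (by linarith)]
    linarith
  refine ⟨hwalk.limitVector γ, hwalk.measurable_limitVector γ,
    hwalk.isNondegenerate_limitVector hd hγ hγ2, ?_, ?_⟩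
  · filter_upwards [ae_all_iff.2 (hwalk.ae_tendsto_sum_X hd hγ hγ2)] with ω hω
    refine tendsto_euclidean_of_forall_succ fun i => (hω i).congr fun n => ?_
    simp [merwPosition]
  · filter_upwards [ae_all_iff.2 (hwalk.ae_tendsto_sum_smul_X hd hγ hγ2 hμ)] with ω hω
    refine tendsto_euclidean_of_forall_succ fun i => (hω i).congr fun n => ?_
    simp [randomStepPosition]
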